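/- **Setting.** A single item is sold to $n$ players. Player $i$'s value $v_i$ is drawn independently from a probability distribution $D_i$ on $[1,H]$ (arbitrary: discrete, continuous or mixed), $H\ge 1$; write $D=\times_i D_i$. A mechanism is given by functions $x_i(b)\ge 0$ with $\sum_i x_i(b)\le 1$ (probability that $i$ gets the item) and $p_i(b)\in\mathbb R$ (expected payment) of the bid profile $b$; player $i$'s utility is $v_i x_i(b)-p_i(b)$. It is DSIC if truthful bidding is optimal for each player for every value and all bids of the others. Its revenue on the instance $\mathcal I$ with prior $D$ is $Rev(\mathcal M(\mathcal I))=\mathbb E_{v\sim D}\sum_i p_i(v)$. $OPT(\mathcal I)$ is the supremum of the revenue over all measurable mechanisms, with well-defined expected payments, that are Bayesian incentive compatible and interim individually rational for $D$ (player $i$'s types and reports ranging over the support of $D_i$). A value query $v$ to the oracle for $D_i$ is answered by $\Pr_{x\sim D_i}[x\ge v]$; the query complexity is the total number of (non-adaptive) queries. **Myerson's mechanism** $\mathcal M_{MRS}$ for a product prior $F=\times_i F_i$. The ironed revenue curve of $F_i$ is the least concave function on quantiles lying above all points $(\Pr_{F_i}[x\ge v],\,v\Pr_{F_i}[x\ge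 v])$, $v\in\mathbb R$; the ironed virtual value $\bar\varphi_i(b_i)$ of a bid $b_i$ is the right derivative of this curve at the quantile $\Pr_{F_i}[x>b_i]$ (and $-\infty$ if that quantile is $1$). The item goes to the player with the largest ironed virtual value provided it is non-negative, ties being broken in favour of the smallest index; the winner pays the infimum of the bids with which he would still win, and the others pay $0$. **Mechanism $\mathcal M_{EVM}$** with parameters $H$ and $\epsilon>0$. Let $k=\lceil\log_{1+\epsilon}H\rceil$ and $(u_0,\dots,u_k)=(1,1+\epsilon,\dots,(1+\epsilon)^{k-1},H)$. For each $i$, query the oracle for $D_i$ at $u_0,\dots,u_k$, with answers $q_{i,0},\dots,q_{i,k}$; put $q_{i,k+1}=0$ and let $D_i'$ be the discrete distribution with mass $q_{i,l}-q_{i,l+1}$ at $u_l$, $0\le l\le k$. Then run $\mathcal M_{MRS}$ for the prior $D'=\times_i D_i'$ on the players' bids. **Theorem.** There is an absolute constant $C>0$ such that for all $n$, all $\epsilon>0$, all $H\ge 1$, and every single-item instance $\mathcal I$ with $n$ players and independent values in $[1,H]$: $\mathcal M_{EVM}$ is feasible, ex-post individually rational and DSIC; it makes at most $C\,n\max\{1,\log_{1+\epsilon}H\}$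 value queries (in particular $O(n\log_{1+\epsilon}H)$ when $H\ge 1+\epsilon$); and its payments are integrable and $$Rev(\mathcal M_{EVM}(\mathcal I))\ \ge\ \frac{OPT(\mathcal I)}{1+\epsilon}.$$ -/

import Mathlib

open MeasureTheory

namespace SingleItemAuction

noncomputable section

/-- A (possibly randomized) direct single-item mechanism with `n` players: given the bid profile `b`,
player `i` receives the item with probability `alloc b i` and makes the expected payment `pay b i`. -/
structure Mechanism (n : ℕ) where
  alloc : (Fin n → ℝ) → Fin n → ℝ
  pay : (Fin n → ℝ) → Fin n → ℝ

namespace Mechanism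

variable {n : ℕ}

/-- The item is sold at most once. -/
def IsFeasible (M : Mechanism n) : Prop :=
  ∀ b, (∀ i, 0 ≤ M.alloc b i) ∧ ∑ i, M.alloc b i ≤ 1

/-- The utility of player `i` with true value `v` when the bid profile is `b`. -/
def utility (M : Mechanism n) (i : Fin n) (v : ℝ) (b : Fin n → ℝ) : ℝ :=
  v * M.alloc b i - M.pay b i

/-- Dominant-strategy incentive compatibility: whatever the others bid, player `i` with value `v`
does at least as well by bidding `v` as by bidding any `z`. -/
def IsDSIC (M : Mechanism n) : Prop :=
  ∀ (i : Fin n) (b : Fin n → ℝ) (v z : ℝ),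
    M.utility i v (Function.update b i z) ≤ M.utility i v (Function.update b i v)

/-- Ex-post individual rationality: a truthful player never has negative utility. -/
def IsExPostIR (M : Mechanism n) : Prop :=
  ∀ (b : Fin n → ℝ) (i : Fin n), 0 ≤ M.utility i (b i) b

/-- Expected revenue when the players bid truthfully and values are drawn independently from `D`. -/
def revenue (M : Mechanism n) (D : Fin n → Measure ℝ) : ℝ :=
  ∫ v, ∑ i, M.pay v i ∂(Measure.pi D)

/-- The interim utility of player `i` with true value `v` who bids `z`, the others being truthful.
(The `i`-th coordinate of the integration variable is overwritten by `z`.) -/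
def interimUtility (M : Mechanism n) (D : Fin n → Measure ℝ) (i : Fin n) (v z : ℝ) : ℝ :=
  ∫ w, M.utility i v (Function.update w i z) ∂(Measure.pi D)

/-- `M` is a feasible, Bayesian incentive compatible and interim individually rational mechanism for
the prior `×ᵢ Dᵢ`; the type space of player `i` is the support of `D i`.  The three regularity fields
say that the expectations occurring here and in `revenue` exist. -/
structure IsBIC (M : Mechanism n) (D : Fin n → Measure ℝ) : Prop where
  feasible : M.IsFeasible
  measurable_alloc : ∀ i, Measurable fun b => M.alloc b i
  integrable_pay : ∀ i, Integrable (fun b => M.pay b i) (Measure.pi D)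
  integrable_interim : ∀ i, ∀ z ∈ (D i).support,
    Integrable (fun w => M.pay (Function.update w i z) i) (Measure.pi D)
  ic : ∀ i, ∀ v ∈ (D i).support, ∀ z ∈ (D i).support,
    M.interimUtility D i v z ≤ M.interimUtility D i v v
  ir : ∀ i, ∀ v ∈ (D i).support, 0 ≤ M.interimUtility D i v v

end Mechanism

/-- The optimal BIC revenue of the single-item instance with prior `×ᵢ Dᵢ`. -/
def OPT {n : ℕ} (D : Fin n → Measure ℝ) : EReal :=
  ⨆ (M : Mechanism n) (_ : M.IsBIC D), (M.revenue D : EReal)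

/-! ### Myerson's mechanism -/

/-- The ironed revenue curve of `F` at the quantile `q`.  Posting the price `v` sells with
probability `Pr[x ≥ v]` and yields `v * Pr[x ≥ v]`; the ironed revenue curve is the least concave
function on quantiles above all these points, i.e. the infimum of the affine functions above them. -/
def ironedRevenue (F : Measure ℝ) (q : ℝ) : ℝ :=
  sInf {y : ℝ | ∃ α β : ℝ,
    (∀ v : ℝ, v * F.real (Set.Ici v) ≤ α + β * F.real (Set.Ici v)) ∧ y = α + β * q}

/-- The ironed virtual value of a bid `b` under `F`: the right derivative of the ironed revenue curve
at the quantile `t = Pr[x > b]`.  As the curve is concave, this is the supremum of the slopes of its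
secants over `[t, q]`, `t < q ≤ 1`.  For a finitely supported `F` it is the slope of the curve on the
quantile interval `[Pr[x > s], Pr[x ≥ s]]` where `s` is the largest support point with `s ≤ b`; if
there is no such point, then `t = 1` and the value is `⊥ = -∞`. -/
def ironedVirtualValue (F : Measure ℝ) (b : ℝ) : EReal :=
  ⨆ q ∈ Set.Ioc (F.real (Set.Ioi b)) 1,
    (((ironedRevenue F q - ironedRevenue F (F.real (Set.Ioi b))) /
      (q - F.real (Set.Ioi b)) : ℝ) : EReal)

/-- Player `i` wins in Myerson's auction if his ironed virtual value is non-negative and largest,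
ties being broken in favour of the smallest index. -/
def MyersonWins {n : ℕ} (F : Fin n → Measure ℝ) (b : Fin n → ℝ) (i : Fin n) : Prop :=
  0 ≤ ironedVirtualValue (F i) (b i) ∧
  ∀ j, j ≠ i →
    ironedVirtualValue (F j) (b j) < ironedVirtualValue (F i) (b i) ∨
    (ironedVirtualValue (F j) (b j) = ironedVirtualValue (F i) (b i) ∧ i < j)

open Classical in
/-- Myerson's mechanism for the prior `×ᵢ Fᵢ`: the winner gets the item and pays his threshold bid,
the infimum of the bids with which he still wins. -/
def myerson {n : ℕ} (F : Fin n → Measure ℝ) : Mechanism n where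
  alloc b i := if MyersonWins F b i then 1 else 0
  pay b i := if MyersonWins F b i then
    sInf {z : ℝ | MyersonWins F (Function.update b i z) i} else 0

/-! ### Value queries -/

/-- A mechanism that accesses the prior only through non-adaptive value queries: it sends the values
`query i l` to the oracle for player `i`'s distribution, and from all the answers it determines the
mechanism that is run on the bids. -/
structure ValueQueryMechanism (n : ℕ) where
  numQueries : Fin n → ℕ
  query : (i : Fin n) → Fin (numQueries i) → ℝ
  run : ((i : Fin n) → Fin (numQueries i) → ℝ) → Mechanism n

namespace ValueQueryMechanism

variable {n : ℕ}

/-- The total number of queries made. -/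
def queryComplexity (A : ValueQueryMechanism n) : ℕ := ∑ i, A.numQueries i

/-- The mechanism that results when the oracles hold the distributions `D i`, so that the query `v`
about player `i` is answered by the quantile `Pr_{x ∼ Dᵢ}[x ≥ v]`. -/
def onPrior (A : ValueQueryMechanism n) (D : Fin n → Measure ℝ) : Mechanism n :=
  A.run fun i l => (D i).real (Set.Ici (A.query i l))

end ValueQueryMechanism

/-- `k = ⌈log_{1+δ} H⌉`. -/
def gridSize (H δ : ℝ) : ℕ := ⌈Real.logb (1 + δ) H⌉₊

/-- The value vector `(1, 1+δ, (1+δ)², …, (1+δ)^(k-1), H)`. -/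
def gridValue (H δ : ℝ) (l : Fin (gridSize H δ + 1)) : ℝ :=
  if (l : ℕ) = gridSize H δ then H else (1 + δ) ^ (l : ℕ)

/-- The discrete distribution that is built from the answers `q` to the queries `gridValue H δ`:
it puts the mass `q_l - q_{l+1}` on the `l`-th grid value, where `q_{k+1} = 0`. -/
def learnedDist (H δ : ℝ) (q : Fin (gridSize H δ + 1) → ℝ) : Measure ℝ :=
  ∑ l : Fin (gridSize H δ + 1),
    ENNReal.ofReal (q l - if h : (l : ℕ) + 1 < gridSize H δ + 1 then q ⟨l + 1, h⟩ else 0) •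
      Measure.dirac (gridValue H δ l)

/-- The efficient value Myerson mechanism: query every player's distribution at the grid values and
run Myerson's mechanism with the learned distributions. -/
def efficientValueMyerson (n : ℕ) (H ε : ℝ) : ValueQueryMechanism n where
  numQueries _ := gridSize H ε + 1
  query _ := gridValue H ε
  run q := myerson fun i => learnedDist H ε (q i)

end

end SingleItemAuction

namespace SingleItemAuction

/-- The quantile `Pr[x ≥ u l]` of the grid value `u l`. -/
noncomputable def gridQuantile (D : Measure ℝ) (u : ℕ → ℝ) (l : ℕ) : ℝ := D.real (Set.Ici (u l))

/-- The law of a `D`-distributed value after rounding down to the grid `u 0, …, u k`. -/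
noncomputable def roundedDist (D : Measure ℝ) (u : ℕ → ℝ) (k : ℕ) : Measure ℝ :=
  ∑ l ∈ Finset.range (k + 1),
    ENNReal.ofReal (gridQuantile D u l - gridQuantile D u (l + 1)) • Measure.dirac (u l)

/-- The grid `u 0 < u 1 < …` covers the values of `D`: these lie in `[u 0, u (k + 1))`. -/
structure IsGrid (D : Measure ℝ) (u : ℕ → ℝ) (k : ℕ) : Prop where
  strictMono : StrictMono u
  quantile_zero : gridQuantile D u 0 = 1
  quantile_last : gridQuantile D u (k + 1) = 0

/-! ### Quantiles of the rounded distribution. -/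

section Grid

variable {D : Measure ℝ} [IsProbabilityMeasure D] {u : ℕ → ℝ} {k : ℕ}

lemma IsGrid.quantile_antitone (hg : IsGrid D u k) : Antitone (gridQuantile D u) := by
  intro a b hab
  exact measureReal_mono (Set.Ici_subset_Ici.2 (hg.strictMono.monotone hab))

lemma gridQuantile_mem (l : ℕ) : gridQuantile D u l ∈ Set.Icc (0 : ℝ) 1 :=
  ⟨measureReal_nonneg, measureReal_le_one⟩

lemma IsGrid.roundedDist_real (hg : IsGrid D u k) {S : Set ℝ} (hS : MeasurableSet S) {l : ℕ}
    (hl : l ≤ k + 1) (h : ∀ j ≤ k, u j ∈ S ↔ l ≤ j) :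
    (roundedDist D u k).real S = gridQuantile D u l := by
  have h1 : (roundedDist D u k).real S =
      ∑ j ∈ Finset.range (k + 1), if l ≤ j then
        gridQuantile D u j - gridQuantile D u (j + 1) else 0 := by
    unfold roundedDist
    rw [measureReal_def, Measure.finsetSum_apply, ENNReal.toReal_sum]
    · refine Finset.sum_congr rfl fun j hj => ?_
      have hj' : j ≤ k := by simpa [Nat.lt_succ_iff] using hj
      have hn : 0 ≤ gridQuantile D u j - gridQuantile D u (j + 1) :=
        sub_nonneg.2 (hg.quantile_antitone (Nat.le_succ j))
      rw [Measure.smul_apply, Measure.dirac_apply' _ hS]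
      by_cases hlj : l ≤ j
      · simp [hlj, (h j hj').2 hlj, hn]
      · have : u j ∉ S := fun hu => hlj ((h j hj').1 hu)
        simp [hlj, this]
    · intro j _
      rw [Measure.smul_apply, Measure.dirac_apply' _ hS]
      by_cases hu : u j ∈ S <;> simp [hu]
  rw [h1, ← Finset.sum_filter]
  have h2 : (Finset.range (k + 1)).filter (fun j => l ≤ j) = Finset.Ico l (k + 1) := by
    ext j; simp [and_comm]
  have h3 := Finset.sum_Ico_sub (fun j => - gridQuantile D u j) hl
  rw [h2]
  simp only [hg.quantile_last] at h3
  calc _ = ∑ j ∈ Finset.Ico l (k + 1), (-gridQuantile D u (j + 1) - -gridQuantile D u j) :=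
        Finset.sum_congr rfl fun j _ => by ring
    _ = _ := by rw [h3]; ring

/-- Every posted price is dominated by a grid price with the same quantile. -/
lemma IsGrid.roundedDist_Ici (hg : IsGrid D u k) (v : ℝ) :
    (roundedDist D u k).real (Set.Ici v) = 0 ∨
      ∃ l ≤ k, v ≤ u l ∧ (roundedDist D u k).real (Set.Ici v) = gridQuantile D u l := by
  by_cases hv : ∃ l, l ≤ k ∧ v ≤ u l
  · right
    classical
    refine ⟨Nat.find hv, (Nat.find_spec hv).1, (Nat.find_spec hv).2, ?_⟩
    refine hg.roundedDist_real measurableSet_Ici ((Nat.find_spec hv).1.trans (Nat.le_succ k)) ?_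
    intro j hj
    refine ⟨fun h => Nat.find_min' hv ⟨hj, h⟩, fun h => ?_⟩
    exact (Nat.find_spec hv).2.trans (hg.strictMono.monotone h)
  · left
    push Not at hv
    rw [← hg.quantile_last]
    refine hg.roundedDist_real measurableSet_Ici le_rfl fun j hj => ?_
    have := hv j hj
    simp only [Set.mem_Ici]
    constructor <;> intro h
    · linarith
    · omega

lemma IsGrid.roundedDist_Ici_grid (hg : IsGrid D u k) {l : ℕ} (hl : l ≤ k) :
    (roundedDist D u k).real (Set.Ici (u l)) = gridQuantile D u l :=
  hg.roundedDist_real measurableSet_Ici (by omega) fun j _ => by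
    simp [hg.strictMono.le_iff_le]

lemma IsGrid.roundedDist_Ioi_grid (hg : IsGrid D u k) {l : ℕ} (hl : l ≤ k) :
    (roundedDist D u k).real (Set.Ioi (u l)) = gridQuantile D u (l + 1) :=
  hg.roundedDist_real measurableSet_Ioi (by omega) fun j _ => by
    simp [hg.strictMono.lt_iff_lt]

lemma IsGrid.roundedDist_Ioi_of_mem (hg : IsGrid D u k) {l : ℕ} (hl : l ≤ k) {b : ℝ}
    (hb : b ∈ Set.Ico (u l) (u (l + 1))) :
    (roundedDist D u k).real (Set.Ioi b) = gridQuantile D u (l + 1) :=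
  hg.roundedDist_real measurableSet_Ioi (by omega) fun j _ => by
    constructor
    · intro h
      exact hg.strictMono.lt_iff_lt.1 (hb.1.trans_lt h)
    · intro h
      exact hb.2.trans_le (hg.strictMono.monotone h)

lemma IsGrid.roundedDist_Ioi_of_lt (hg : IsGrid D u k) {b : ℝ} (hb : b < u 0) :
    (roundedDist D u k).real (Set.Ioi b) = 1 := by
  rw [← hg.quantile_zero]
  exact hg.roundedDist_real measurableSet_Ioi (by omega) fun j _ => by
    simpa using hb.trans_le (hg.strictMono.monotone (Nat.zero_le j))

lemma IsGrid.exists_roundedDist_Ioi_eq (hg : IsGrid D u k) {b : ℝ} (hb : u 0 ≤ b) :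
    ∃ l ≤ k, u l ≤ b ∧
      (roundedDist D u k).real (Set.Ioi b) = (roundedDist D u k).real (Set.Ioi (u l)) := by
  by_cases hk : u k ≤ b
  · refine ⟨k, le_rfl, hk, ?_⟩
    rw [hg.roundedDist_Ioi_grid le_rfl]
    refine hg.roundedDist_real measurableSet_Ioi le_rfl fun j hj => ?_
    have := hg.strictMono.monotone hj
    simp only [Set.mem_Ioi]
    constructor <;> intro h
    · linarith
    · omega
  · classical
    have hex : ∃ l, b < u l := ⟨k, not_le.1 hk⟩
    obtain ⟨l, hl⟩ : ∃ l, Nat.find hex = l + 1 := by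
      refine Nat.exists_eq_succ_of_ne_zero fun h0 => ?_
      have := Nat.find_spec hex
      rw [h0] at this
      linarith
    have h1 : b < u (l + 1) := hl ▸ Nat.find_spec hex
    have h2 : u l ≤ b := not_lt.1 (Nat.find_min hex (by omega))
    have h3 : l + 1 ≤ k := hl ▸ Nat.find_min' hex (not_le.1 hk)
    exact ⟨l, by omega, h2, by
      rw [hg.roundedDist_Ioi_of_mem (by omega) ⟨h2, h1⟩, hg.roundedDist_Ioi_grid (by omega)]⟩

/-! ### The ironed revenue curve of the rounded distribution -/

/-- The prices `u (k + 1)` and `u 0` have quantiles 0 and 1. Testing a dominating line there bounds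
it below on `[0, 1]`, which makes the infimum in `ironedRevenue` meaningful. -/
lemma IsGrid.line_nonneg (hg : IsGrid D u k) {α β : ℝ}
    (h : ∀ v : ℝ, v * (roundedDist D u k).real (Set.Ici v) ≤
      α + β * (roundedDist D u k).real (Set.Ici v)) : 0 ≤ α ∧ u 0 ≤ α + β := by
  constructor
  · have h1 : (roundedDist D u k).real (Set.Ici (u (k + 1))) = 0 := by
      rw [← hg.quantile_last]
      exact hg.roundedDist_real measurableSet_Ici le_rfl fun j _ => by
        simp [hg.strictMono.le_iff_le]
    simpa [h1] using h (u (k + 1))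
  · simpa [hg.roundedDist_Ici_grid (Nat.zero_le k), hg.quantile_zero] using h (u 0)

lemma IsGrid.ironedRevenue_le (hg : IsGrid D u k) {α β q : ℝ} (hq : q ∈ Set.Icc (0 : ℝ) 1)
    (h : ∀ v : ℝ, v * (roundedDist D u k).real (Set.Ici v) ≤
      α + β * (roundedDist D u k).real (Set.Ici v)) :
    ironedRevenue (roundedDist D u k) q ≤ α + β * q := by
  -- The lower bound interpolates between the bounds 0 at quantile 0 and `u 0` at quantile 1.
  refine csInf_le ⟨q * u 0, ?_⟩ ⟨α, β, h, rfl⟩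
  rintro y ⟨a, b, hab, rfl⟩
  obtain ⟨h1, h2⟩ := hg.line_nonneg hab
  nlinarith [hq.1, hq.2, mul_le_mul_of_nonneg_left h2 hq.1, mul_nonneg (sub_nonneg.2 hq.2) h1]

/-- The lines above the revenue points with a prescribed slope are supported by a revenue point. -/
lemma IsGrid.exists_supporting_line (hg : IsGrid D u k) (c : ℝ) :
    (∀ v : ℝ, v * (roundedDist D u k).real (Set.Ici v) ≤
      0 + c * (roundedDist D u k).real (Set.Ici v)) ∨
    ∃ l ≤ k, ∀ v : ℝ, v * (roundedDist D u k).real (Set.Ici v) ≤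
      (u l - c) * gridQuantile D u l + c * (roundedDist D u k).real (Set.Ici v) := by
  obtain ⟨l, hl, hmax⟩ := Finset.exists_max_image (Finset.range (k + 1))
    (fun l => (u l - c) * gridQuantile D u l) ⟨0, by simp⟩
  have key : ∀ a : ℝ, 0 ≤ a → (u l - c) * gridQuantile D u l ≤ a → ∀ v : ℝ,
      v * (roundedDist D u k).real (Set.Ici v) ≤
        a + c * (roundedDist D u k).real (Set.Ici v) := by
    intro a ha hla v
    rcases hg.roundedDist_Ici v with h | ⟨j, hj, hvj, h⟩
    · simpa [h] using ha
    · rw [h]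
      have h1 := hmax j (by simp; omega)
      have h2 := mul_le_mul_of_nonneg_right hvj (gridQuantile_mem (D := D) (u := u) j).1
      nlinarith
  -- If no grid price has positive intercept, the line is supported by the origin, the revenue point
  -- of an unsellable price.
  by_cases h0 : (u l - c) * gridQuantile D u l ≤ 0
  · exact Or.inl (key 0 le_rfl h0)
  · exact Or.inr ⟨l, by simpa [Nat.lt_succ_iff] using hl, key _ (not_le.1 h0).le le_rfl⟩

lemma IsGrid.le_ironedRevenue (hg : IsGrid D u k) {q y : ℝ}
    (h : ∀ α β : ℝ, (∀ v : ℝ, v * (roundedDist D u k).real (Set.Ici v) ≤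
      α + β * (roundedDist D u k).real (Set.Ici v)) → y ≤ α + β * q) :
    y ≤ ironedRevenue (roundedDist D u k) q := by
  refine le_csInf ?_ ?_
  · rcases hg.exists_supporting_line 0 with h0 | ⟨l, _, h0⟩
    · exact ⟨_, _, _, h0, rfl⟩
    · exact ⟨_, _, _, h0, rfl⟩
  · rintro _ ⟨α, β, hab, rfl⟩
    exact h α β hab

lemma IsGrid.le_ironedRevenue_grid (hg : IsGrid D u k) {l : ℕ} (hl : l ≤ k) :
    u l * gridQuantile D u l ≤ ironedRevenue (roundedDist D u k) (gridQuantile D u l) := by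
  refine hg.le_ironedRevenue fun α β h => ?_
  simpa [hg.roundedDist_Ici_grid hl] using h (u l)

lemma IsGrid.ironedRevenue_zero (hg : IsGrid D u k) :
    ironedRevenue (roundedDist D u k) 0 = 0 := by
  refine le_antisymm ?_ (hg.le_ironedRevenue fun α β h => by
    simpa using (hg.line_nonneg h).1)
  -- No price that sells exceeds `u k`, so the line of slope `u k` through the origin dominates.
  have := hg.ironedRevenue_le (α := 0) (β := u k) (q := 0) (by simp) fun v => by
    rcases hg.roundedDist_Ici v with h | ⟨j, hj, hvj, h⟩
    · simp [h]
    · rw [zero_add]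
      exact mul_le_mul_of_nonneg_right (hvj.trans (hg.strictMono.monotone hj)) measureReal_nonneg
  simpa using this

lemma IsGrid.concaveOn_ironedRevenue (hg : IsGrid D u k) :
    ConcaveOn ℝ (Set.Icc 0 1) (ironedRevenue (roundedDist D u k)) := by
  refine ⟨convex_Icc 0 1, fun x hx y hy a b ha hb hab => hg.le_ironedRevenue fun α β h => ?_⟩
  have h1 := mul_le_mul_of_nonneg_left (hg.ironedRevenue_le hx h) ha
  have h2 := mul_le_mul_of_nonneg_left (hg.ironedRevenue_le hy h) hb
  simp only [smul_eq_mul]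
  have : α = (a + b) * α := by rw [hab, one_mul]
  linarith [this, show (a + b) * α = a * α + b * α by ring,
    show a * (α + β * x) + b * (α + β * y) = a * α + b * α + β * (a * x + b * y) by ring]

/-- For every slope `c`, the curve `q ↦ R(q) - c q` is maximal at a revenue point on the curve. -/
lemma IsGrid.exists_maximizer (hg : IsGrid D u k) (c : ℝ) :
    ∃ l ≤ k + 1, (l ≤ k → ∀ q ∈ Set.Icc (0 : ℝ) 1, ironedRevenue (roundedDist D u k) q - c * q ≤
        u l * gridQuantile D u l - c * gridQuantile D u l) ∧
      ∀ q ∈ Set.Icc (0 : ℝ) 1, ironedRevenue (roundedDist D u k) q - c * q ≤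
        ironedRevenue (roundedDist D u k) (gridQuantile D u l) - c * gridQuantile D u l := by
  rcases hg.exists_supporting_line c with h | ⟨l, hl, h⟩
  -- Index `k + 1`, of quantile 0, encodes the origin.
  · refine ⟨k + 1, le_rfl, fun h => by omega, fun q hq => ?_⟩
    rw [hg.quantile_last, hg.ironedRevenue_zero]
    linarith [hg.ironedRevenue_le hq h]
  · have h1 : ∀ q ∈ Set.Icc (0 : ℝ) 1, ironedRevenue (roundedDist D u k) q - c * q ≤
        u l * gridQuantile D u l - c * gridQuantile D u l := fun q hq => by
      linarith [hg.ironedRevenue_le hq h]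
    exact ⟨l, by omega, fun _ => h1, fun q hq => (h1 q hq).trans
      (by linarith [hg.le_ironedRevenue_grid hl])⟩

/-- Quasiconcavity survives tilting by a linear term. Together with `exists_maximizer` it locates
slopes and kinks without describing the hull explicitly. -/
lemma IsGrid.min_le_of_mem_Icc (hg : IsGrid D u k) (c : ℝ) {x y z : ℝ}
    (hx : x ∈ Set.Icc (0 : ℝ) 1) (hz : z ∈ Set.Icc (0 : ℝ) 1) (hxy : x ≤ y) (hyz : y ≤ z) :
    min (ironedRevenue (roundedDist D u k) x - c * x)
      (ironedRevenue (roundedDist D u k) z - c * z) ≤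
      ironedRevenue (roundedDist D u k) y - c * y := by
  have h := hg.concaveOn_ironedRevenue.sub
    (g := fun x => c * x) ⟨convex_Icc 0 1, fun x _ y _ a b _ _ _ => by
      simp only [smul_eq_mul]; exact le_of_eq (by ring)⟩
  exact h.min_le_of_mem_Icc hx hz ⟨hxy, hyz⟩

/-- The ironed revenue curve is linear between consecutive grid quantiles: none of its secants from
the left one is steeper than the one to the right one. -/
lemma IsGrid.secant_le (hg : IsGrid D u k) {l : ℕ}
    (hm : gridQuantile D u (l + 1) < gridQuantile D u l) {q : ℝ}
    (hq : q ∈ Set.Ioc (gridQuantile D u (l + 1)) 1) :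
    (ironedRevenue (roundedDist D u k) q -
        ironedRevenue (roundedDist D u k) (gridQuantile D u (l + 1))) /
      (q - gridQuantile D u (l + 1)) ≤
    (ironedRevenue (roundedDist D u k) (gridQuantile D u l) -
        ironedRevenue (roundedDist D u k) (gridQuantile D u (l + 1))) /
      (gridQuantile D u l - gridQuantile D u (l + 1)) := by
  by_contra hlt
  -- With `g q = R q - c * q`, this gives `g (q l) < g (q (l+1)) < g q`. A global maximizer at a
  -- grid quantile, on either side of this bin, then contradicts quasiconcavity.
  obtain ⟨c, hc1, hc2⟩ := exists_between (not_le.1 hlt)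
  rw [lt_div_iff₀ (sub_pos.2 hq.1)] at hc2
  rw [div_lt_iff₀ (sub_pos.2 hm)] at hc1
  have ha := gridQuantile_mem (D := D) (u := u) (l + 1)
  have hb := gridQuantile_mem (D := D) (u := u) l
  have hq' : q ∈ Set.Icc (0 : ℝ) 1 := ⟨ha.1.trans hq.1.le, hq.2⟩
  obtain ⟨j, _, _, hj⟩ := hg.exists_maximizer c
  have hjq := hj q hq'
  rcases le_or_gt j l with h | h
  · have := hg.min_le_of_mem_Icc c ha (gridQuantile_mem (D := D) (u := u) j) hm.le
      (hg.quantile_antitone h)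
    rcases min_le_iff.1 this with h | h <;> linarith
  · have := hg.min_le_of_mem_Icc c (gridQuantile_mem (D := D) (u := u) j) hq'
      (hg.quantile_antitone h) hq.1.le
    rcases min_le_iff.1 this with h | h <;> linarith

/-- Where the slope of the ironed revenue curve jumps, the curve passes through the revenue point. -/
lemma IsGrid.ironedRevenue_le_of_kink (hg : IsGrid D u k) {l : ℕ}
    (hm : gridQuantile D u (l + 1) < gridQuantile D u l) {c : ℝ}
    (hright : ∀ q ∈ Set.Ioc (gridQuantile D u l) 1,
      (ironedRevenue (roundedDist D u k) q -
        ironedRevenue (roundedDist D u k) (gridQuantile D u l)) / (q - gridQuantile D u l) < c)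
    (hleft : c < (ironedRevenue (roundedDist D u k) (gridQuantile D u l) -
        ironedRevenue (roundedDist D u k) (gridQuantile D u (l + 1))) /
      (gridQuantile D u l - gridQuantile D u (l + 1))) (hl : l ≤ k) :
    ironedRevenue (roundedDist D u k) (gridQuantile D u l) ≤ u l * gridQuantile D u l := by
  rw [lt_div_iff₀ (sub_pos.2 hm)] at hleft
  have ha := gridQuantile_mem (D := D) (u := u) (l + 1)
  have hb := gridQuantile_mem (D := D) (u := u) l
  -- Since `c` separates the slopes on the two sides, `R q - c * q` peaks only at the quantile of
  -- `l`, so the maximizing index `j` has that quantile.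
  obtain ⟨j, _, hj1, hj⟩ := hg.exists_maximizer c
  have hjq := gridQuantile_mem (D := D) (u := u) j
  have hjl := hj _ hb
  rcases lt_or_ge l j with h | h
  · have := hg.min_le_of_mem_Icc c hjq hb (hg.quantile_antitone h) hm.le
    rcases min_le_iff.1 this with h | h <;> linarith
  · rcases (hg.quantile_antitone h).eq_or_lt with heq | hlt
    -- Several prices may share this quantile; `j ≤ l` gives `u j ≤ u l`, the direction needed.
    · have h1 := hj1 (by omega) _ hb
      rw [← heq] at h1
      have h2 := mul_le_mul_of_nonneg_right (hg.strictMono.monotone h) hb.1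
      linarith
    · have h1 := hright _ ⟨hlt, hjq.2⟩
      rw [div_lt_iff₀ (sub_pos.2 hlt)] at h1
      linarith

/-! ### Ironed virtual values of the rounded distribution -/

lemma ironedVirtualValue_congr {F : Measure ℝ} {b c : ℝ}
    (h : F.real (Set.Ioi b) = F.real (Set.Ioi c)) :
    ironedVirtualValue F b = ironedVirtualValue F c := by
  unfold ironedVirtualValue
  rw [h]

lemma ironedVirtualValue_of_quantile_one {F : Measure ℝ} {b : ℝ}
    (h : F.real (Set.Ioi b) = 1) : ironedVirtualValue F b = ⊥ := by
  unfold ironedVirtualValue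
  rw [h]
  simp

lemma IsGrid.ironedVirtualValue_of_lt (hg : IsGrid D u k) {b : ℝ} (hb : b < u 0) :
    ironedVirtualValue (roundedDist D u k) b = ⊥ :=
  ironedVirtualValue_of_quantile_one (hg.roundedDist_Ioi_of_lt hb)

lemma IsGrid.exists_ironedVirtualValue_eq (hg : IsGrid D u k) {b : ℝ} (hb : u 0 ≤ b) :
    ∃ l ≤ k, u l ≤ b ∧
      ironedVirtualValue (roundedDist D u k) b = ironedVirtualValue (roundedDist D u k) (u l) := by
  obtain ⟨l, hl, hlb, h⟩ := hg.exists_roundedDist_Ioi_eq hb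
  exact ⟨l, hl, hlb, ironedVirtualValue_congr h⟩

/-- By `secant_le`, the supremum of secant slopes is attained at the other end of the bin. Positive
bin mass keeps the quotient nondegenerate. -/
lemma IsGrid.ironedVirtualValue_eq (hg : IsGrid D u k) {l : ℕ} (hl : l ≤ k)
    (hm : gridQuantile D u (l + 1) < gridQuantile D u l) {b : ℝ}
    (hb : b ∈ Set.Ico (u l) (u (l + 1))) :
    ironedVirtualValue (roundedDist D u k) b =
      ((ironedRevenue (roundedDist D u k) (gridQuantile D u l) -
        ironedRevenue (roundedDist D u k) (gridQuantile D u (l + 1))) /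
      (gridQuantile D u l - gridQuantile D u (l + 1)) : ℝ) := by
  unfold ironedVirtualValue
  rw [hg.roundedDist_Ioi_of_mem hl hb]
  refine le_antisymm (iSup₂_le fun q hq => EReal.coe_le_coe_iff.2 (hg.secant_le hm hq)) ?_
  exact le_iSup₂ (f := fun q (_ : q ∈ Set.Ioc (gridQuantile D u (l + 1)) 1) =>
    (((ironedRevenue (roundedDist D u k) q -
        ironedRevenue (roundedDist D u k) (gridQuantile D u (l + 1))) /
      (q - gridQuantile D u (l + 1)) : ℝ) : EReal)) (gridQuantile D u l)
    ⟨hm, (gridQuantile_mem l).2⟩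

instance isFiniteMeasure_roundedDist : IsFiniteMeasure (roundedDist D u k) := by
  refine ⟨?_⟩
  rw [roundedDist, Measure.finsetSum_apply]
  exact ENNReal.sum_lt_top.2 fun l _ => by simp

/-- A higher bid moves the base quantile left, and by concavity a secant with fixed right end gets
no flatter. -/
lemma IsGrid.monotone_ironedVirtualValue (hg : IsGrid D u k) :
    Monotone (ironedVirtualValue (roundedDist D u k)) := by
  intro b c hbc
  have ht : (roundedDist D u k).real (Set.Ioi c) ≤ (roundedDist D u k).real (Set.Ioi b) :=
    measureReal_mono (Set.Ioi_subset_Ioi hbc)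
  refine iSup₂_le fun q hq => ?_
  have h0 : 0 ≤ (roundedDist D u k).real (Set.Ioi c) := measureReal_nonneg
  refine le_trans ?_ (le_iSup₂ (f := fun q (_ : q ∈ Set.Ioc ((roundedDist D u k).real
    (Set.Ioi c)) 1) => (((ironedRevenue (roundedDist D u k) q - ironedRevenue (roundedDist D u k)
      ((roundedDist D u k).real (Set.Ioi c))) /
      (q - (roundedDist D u k).real (Set.Ioi c)) : ℝ) : EReal)) q ⟨ht.trans_lt hq.1, hq.2⟩)
  rw [EReal.coe_le_coe_iff]
  rcases ht.eq_or_lt with heq | hlt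
  · rw [heq]
  · have hb1 : (roundedDist D u k).real (Set.Ioi b) ≤ 1 := hq.1.le.trans hq.2
    have hq' : q ∈ Set.Icc (0 : ℝ) 1 := ⟨h0.trans (hlt.le.trans hq.1.le), hq.2⟩
    have h := hg.concaveOn_ironedRevenue.slope_anti_adjacent 
      (x := (roundedDist D u k).real (Set.Ioi c)) ⟨h0, hlt.le.trans hb1⟩ hq' hlt hq.1
    rw [div_le_div_iff₀ (by linarith [hq.1]) (by linarith)] at h
    rw [div_le_div_iff₀ (by linarith [hq.1]) (by linarith [hq.1])]
    nlinarith

end Grid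

/-! ### Virtual values as a real step function -/

/-- The slope of the ironed revenue curve of the rounded distribution between two consecutive grid
quantiles. -/
noncomputable def gridSlope (D : Measure ℝ) (u : ℕ → ℝ) (k l : ℕ) : ℝ :=
  (ironedRevenue (roundedDist D u k) (gridQuantile D u l) -
    ironedRevenue (roundedDist D u k) (gridQuantile D u (l + 1))) /
  (gridQuantile D u l - gridQuantile D u (l + 1))

/-- The ironed virtual value of the rounded distribution as a real step function; it agrees with
`ironedVirtualValue` almost everywhere. -/
noncomputable def virtualStep (D : Measure ℝ) (u : ℕ → ℝ) (k : ℕ) (z : ℝ) : ℝ :=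
  ∑ l ∈ Finset.range (k + 1), (Set.Ico (u l) (u (l + 1))).indicator (fun _ => gridSlope D u k l) z

section Step

variable {D : Measure ℝ} {u : ℕ → ℝ} {k : ℕ}

lemma IsGrid.eq_of_mem (hg : IsGrid D u k) {l j : ℕ} {z : ℝ}
    (hl : z ∈ Set.Ico (u l) (u (l + 1))) (hj : z ∈ Set.Ico (u j) (u (j + 1))) : j = l := by
  have h1 := hg.strictMono.lt_iff_lt.1 (hl.1.trans_lt hj.2)
  have h2 := hg.strictMono.lt_iff_lt.1 (hj.1.trans_lt hl.2)
  omega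

lemma IsGrid.virtualStep_eq (hg : IsGrid D u k) {l : ℕ} (hlk : l ≤ k) {z : ℝ}
    (hz : z ∈ Set.Ico (u l) (u (l + 1))) : virtualStep D u k z = gridSlope D u k l := by
  unfold virtualStep
  rw [Finset.sum_eq_single_of_mem l (by simp; omega), Set.indicator_of_mem hz]
  exact fun j _ hj => Set.indicator_of_notMem (fun h => hj (hg.eq_of_mem hz h)) _

lemma measurable_virtualStep : Measurable (virtualStep D u k) :=
  Finset.measurable_sum _ fun _ _ => measurable_const.indicator measurableSet_Ico

lemma norm_virtualStep_le (z : ℝ) :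
    ‖virtualStep D u k z‖ ≤ ∑ l ∈ Finset.range (k + 1), |gridSlope D u k l| := by
  refine (norm_sum_le _ _).trans (Finset.sum_le_sum fun l _ => ?_)
  exact norm_indicator_le_norm_self _ _

lemma integral_virtualStep_mul {x : ℝ → ℝ} (hx : Integrable x D) :
    ∫ z, virtualStep D u k z * x z ∂D =
      ∑ l ∈ Finset.range (k + 1), gridSlope D u k l * ∫ z in Set.Ico (u l) (u (l + 1)), x z ∂D := by
  have h : ∀ z, virtualStep D u k z * x z = ∑ l ∈ Finset.range (k + 1),
      gridSlope D u k l * (Set.Ico (u l) (u (l + 1))).indicator x z := fun z => by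
    unfold virtualStep
    rw [Finset.sum_mul]
    refine Finset.sum_congr rfl fun l _ => ?_
    by_cases hz : z ∈ Set.Ico (u l) (u (l + 1)) <;> simp [hz]
  simp_rw [h]
  rw [integral_finsetSum _ fun l _ => (hx.indicator measurableSet_Ico).const_mul _]
  refine Finset.sum_congr rfl fun l _ => ?_
  rw [integral_const_mul, integral_indicator measurableSet_Ico]

variable [IsProbabilityMeasure D]

lemma IsGrid.real_Ico (hg : IsGrid D u k) {l m : ℕ} (h : l ≤ m) :
    D.real (Set.Ico (u l) (u m)) = gridQuantile D u l - gridQuantile D u m := by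
  have : Set.Ico (u l) (u m) = Set.Ici (u l) \ Set.Ici (u m) := by
    ext z; simp
  rw [this, measureReal_sdiff (Set.Ici_subset_Ici.2 (hg.strictMono.monotone h)) measurableSet_Ici]
  rfl

/-- The countably many null bins can be discarded together; on the others the virtual value is a
real slope. -/
lemma IsGrid.ae_mem_bin (hg : IsGrid D u k) :
    ∀ᵐ z ∂D, ∃ l ≤ k, z ∈ Set.Ico (u l) (u (l + 1)) ∧
      gridQuantile D u (l + 1) < gridQuantile D u l := by
  have h1 : ∀ᵐ z ∂D, z ∈ Set.Ico (u 0) (u (k + 1)) := by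
    have h := hg.real_Ico (Nat.zero_le (k + 1))
    rw [hg.quantile_zero, hg.quantile_last, sub_zero] at h
    refine (mem_ae_iff_prob_eq_one measurableSet_Ico).2 ?_
    rw [← ofReal_measureReal, h, ENNReal.ofReal_one]
  have h2 : ∀ᵐ z ∂D, ∀ l, gridQuantile D u l - gridQuantile D u (l + 1) = 0 →
      z ∉ Set.Ico (u l) (u (l + 1)) := by
    rw [ae_all_iff]
    intro l
    by_cases hl : gridQuantile D u l - gridQuantile D u (l + 1) = 0
    · rw [← hg.real_Ico (Nat.le_succ l), measureReal_eq_zero_iff] at hl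
      filter_upwards [measure_eq_zero_iff_ae_notMem.1 hl] with z hz _ using hz
    · exact Filter.Eventually.of_forall fun z h => absurd h hl
  filter_upwards [h1, h2] with z hz h
  classical
  have hex : ∃ l, z < u (l + 1) := ⟨k, hz.2⟩
  have hbin : z ∈ Set.Ico (u (Nat.find hex)) (u (Nat.find hex + 1)) := by
    refine ⟨?_, Nat.find_spec hex⟩
    rcases Nat.eq_zero_or_pos (Nat.find hex) with h0 | h0
    · rw [h0]; exact hz.1
    · have := Nat.find_min hex (Nat.sub_lt h0 one_pos)
      rw [show Nat.find hex - 1 + 1 = Nat.find hex by omega] at this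
      exact not_lt.1 this
  refine ⟨Nat.find hex, Nat.find_min' hex hz.2, hbin, ?_⟩
  refine lt_of_le_of_ne (hg.quantile_antitone (Nat.le_succ _)) fun heq => ?_
  exact h _ (sub_eq_zero.2 heq.symm) hbin

lemma IsGrid.ae_ironedVirtualValue_eq (hg : IsGrid D u k) :
    ∀ᵐ z ∂D, ironedVirtualValue (roundedDist D u k) z = (virtualStep D u k z : EReal) := by
  filter_upwards [hg.ae_mem_bin] with z ⟨l, hl, hz, hm⟩
  rw [hg.ironedVirtualValue_eq hl hm hz, hg.virtualStep_eq hl hz]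
  rfl

lemma IsGrid.gridSlope_mul (hg : IsGrid D u k) (l : ℕ) :
    gridSlope D u k l * (gridQuantile D u l - gridQuantile D u (l + 1)) =
    ironedRevenue (roundedDist D u k) (gridQuantile D u l) -
      ironedRevenue (roundedDist D u k) (gridQuantile D u (l + 1)) := by
  unfold gridSlope
  rcases (hg.quantile_antitone (Nat.le_succ l)).eq_or_lt with h | h
  · simp [← h]
  · exact div_mul_cancel₀ _ (sub_pos.2 h).ne'

/-- Slope times bin mass is an increment of the curve, and the increments telescope down to `R 0 =
0`. -/
lemma IsGrid.integral_virtualStep_Ici (hg : IsGrid D u k) {l : ℕ} (hl : l ≤ k) :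
    ∫ z, virtualStep D u k z * (Set.Ici (u l)).indicator (fun _ => 1) z ∂D =
      ironedRevenue (roundedDist D u k) (gridQuantile D u l) := by
  rw [integral_virtualStep_mul ((integrable_const _).indicator measurableSet_Ici)]
  have h : ∀ j ∈ Finset.range (k + 1), gridSlope D u k j * ∫ z in Set.Ico (u j) (u (j + 1)),
      (Set.Ici (u l)).indicator (fun _ => (1 : ℝ)) z ∂D = if l ≤ j then
        ironedRevenue (roundedDist D u k) (gridQuantile D u j) -
        ironedRevenue (roundedDist D u k) (gridQuantile D u (j + 1)) else 0 := by
    intro j _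
    rw [setIntegral_indicator measurableSet_Ici]
    split_ifs with hlj
    · have : Set.Ico (u j) (u (j + 1)) ∩ Set.Ici (u l) = Set.Ico (u j) (u (j + 1)) :=
        Set.inter_eq_left.2 fun z hz => (hg.strictMono.monotone hlj).trans hz.1
      rw [this, ← hg.gridSlope_mul, ← hg.real_Ico (Nat.le_succ j)]
      simp
    · have : Set.Ico (u j) (u (j + 1)) ∩ Set.Ici (u l) = ∅ := by
        ext z
        simp only [Set.mem_inter_iff, Set.mem_Ico, Set.mem_Ici, Set.mem_empty_iff_false, iff_false]
        rintro ⟨⟨_, h1⟩, h2⟩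
        have := hg.strictMono.lt_iff_lt.1 (h2.trans_lt h1)
        omega
      rw [this]
      simp
  rw [Finset.sum_congr rfl h, ← Finset.sum_filter]
  have h2 : (Finset.range (k + 1)).filter (fun j => l ≤ j) = Finset.Ico l (k + 1) := by
    ext j; simp [and_comm]
  have h3 := Finset.sum_Ico_sub
    (fun j => - ironedRevenue (roundedDist D u k) (gridQuantile D u j)) (show l ≤ k + 1 by omega)
  simp only [hg.quantile_last, hg.ironedRevenue_zero] at h3
  rw [h2]
  calc _ = ∑ j ∈ Finset.Ico l (k + 1),
        (-ironedRevenue (roundedDist D u k) (gridQuantile D u (j + 1)) -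
          -ironedRevenue (roundedDist D u k) (gridQuantile D u j)) :=
        Finset.sum_congr rfl fun j _ => by ring
    _ = _ := by rw [h3]; ring

/-- A set of bids that is an upper set with respect to the ironed virtual value, on which this value
is nonnegative, is the set of bids above a grid price at which the ironed revenue curve touches the
revenue of that price. -/
lemma IsGrid.eq_empty_or_eq_Ici (hg : IsGrid D u k) {S : Set ℝ}
    (hpos : ∀ z ∈ S, 0 ≤ ironedVirtualValue (roundedDist D u k) z)
    (hup : ∀ y ∈ S, ∀ z, ironedVirtualValue (roundedDist D u k) y ≤
      ironedVirtualValue (roundedDist D u k) z → z ∈ S) :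
    S = ∅ ∨ ∃ l ≤ k, S = Set.Ici (u l) ∧
      ironedRevenue (roundedDist D u k) (gridQuantile D u l) ≤ u l * gridQuantile D u l := by
  classical
  have hgrid : ∀ z ∈ S, ∃ l ≤ k, u l ≤ z ∧ u l ∈ S := by
    intro z hz
    have hz0 : u 0 ≤ z := by
      by_contra hlt
      have := hpos z hz
      rw [hg.ironedVirtualValue_of_lt (not_le.1 hlt)] at this
      simp at this
    obtain ⟨l, hl, hlz, h⟩ := hg.exists_ironedVirtualValue_eq hz0
    exact ⟨l, hl, hlz, hup z hz _ h.le⟩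
  rcases S.eq_empty_or_nonempty with h | ⟨z, hz⟩
  · exact Or.inl h
  right
  have hex : ∃ l, l ≤ k ∧ u l ∈ S := by
    obtain ⟨l, hl, _, h⟩ := hgrid z hz
    exact ⟨l, hl, h⟩
  obtain ⟨l, hfind⟩ : ∃ l, l = Nat.find hex := ⟨_, rfl⟩
  obtain ⟨hlk, hlS⟩ : l ≤ k ∧ u l ∈ S := hfind ▸ Nat.find_spec hex
  have hmin : ∀ j < l, u j ∉ S := fun j hj hjS =>
    Nat.find_min hex (hfind ▸ hj) ⟨by omega, hjS⟩
  have hφl := hg.roundedDist_Ioi_grid hlk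
  refine ⟨l, hlk, ?_, ?_⟩
  · ext y
    constructor
    · intro hy
      obtain ⟨j, _, hjy, hjS⟩ := hgrid y hy
      have : l ≤ j := not_lt.1 fun h => hmin j h hjS
      exact (hg.strictMono.monotone this).trans hjy
    · intro hy
      exact hup _ hlS y (hg.monotone_ironedVirtualValue hy)
  have hanti := hg.quantile_antitone (Nat.le_succ l)
  have hslope : gridQuantile D u (l + 1) < gridQuantile D u l →
      ironedVirtualValue (roundedDist D u k) (u l) = (gridSlope D u k l : EReal) :=
    fun hm => hg.ironedVirtualValue_eq hlk hm ⟨le_rfl, hg.strictMono (Nat.lt_succ_self l)⟩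
  rcases Nat.eq_zero_or_pos l with h0 | h0
  · subst h0
    have hm : gridQuantile D u (0 + 1) < gridQuantile D u 0 := by
      refine lt_of_le_of_ne hanti fun h => ?_
      have := hpos _ hlS
      rw [ironedVirtualValue_of_quantile_one (by rw [hφl, h, hg.quantile_zero])] at this
      simp at this
    -- At quantile 1 there are no secants to the right, so any `c` below the slope will do.
    refine hg.ironedRevenue_le_of_kink hm (c := gridSlope D u k 0 - 1) ?_
      (sub_one_lt _) hlk
    intro q hq
    rw [hg.quantile_zero] at hq
    exact absurd hq.1 (not_lt.2 hq.2)
  · obtain ⟨m, rfl⟩ := Nat.exists_eq_succ_of_ne_zero h0.ne'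
    have hφm := hg.roundedDist_Ioi_grid (show m ≤ k by omega)
    -- Minimality of the threshold forces a strict jump of the virtual value, which is the kink; a
    -- null bin at the threshold would make the two values equal.
    have hlt : ironedVirtualValue (roundedDist D u k) (u m) <
        ironedVirtualValue (roundedDist D u k) (u (m + 1)) := by
      by_contra h
      exact hmin m (Nat.lt_succ_self m) (hup _ hlS _ (not_lt.1 h))
    have hm : gridQuantile D u (m + 1 + 1) < gridQuantile D u (m + 1) := by
      refine lt_of_le_of_ne hanti fun h => hlt.ne (ironedVirtualValue_congr ?_)
      rw [hφm, hφl, h]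
    rw [hslope hm] at hlt
    obtain ⟨c, hc1, hc2⟩ := EReal.lt_iff_exists_real_btwn.1 hlt
    refine hg.ironedRevenue_le_of_kink hm (c := c) ?_ (EReal.coe_lt_coe_iff.1 hc2) hlk
    intro q hq
    rw [← EReal.coe_lt_coe_iff]
    refine lt_of_le_of_lt ?_ hc1
    unfold ironedVirtualValue
    rw [hφm]
    exact le_iSup₂ (f := fun q (_ : q ∈ Set.Ioc (gridQuantile D u (m + 1)) 1) =>
      (((ironedRevenue (roundedDist D u k) q -
        ironedRevenue (roundedDist D u k) (gridQuantile D u (m + 1))) /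
      (q - gridQuantile D u (m + 1)) : ℝ) : EReal)) q hq

end Step

/-! ### Myerson's mechanism for rounded distributions -/

section Myerson

variable {n : ℕ} {F : Fin n → Measure ℝ}

lemma MyersonWins.unique {b : Fin n → ℝ} {i j : Fin n} (hi : MyersonWins F b i)
    (hj : MyersonWins F b j) : i = j := by
  by_contra hne
  rcases hi.2 j (Ne.symm hne) with h1 | ⟨h1, h2⟩ <;> rcases hj.2 i hne with h3 | ⟨h3, h4⟩
  · exact lt_asymm h1 h3
  · exact h1.ne h3.symm
  · exact h3.ne h1.symm
  · exact lt_asymm h2 h4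

lemma isFeasible_myerson (F : Fin n → Measure ℝ) : (myerson F).IsFeasible := by
  classical
  intro b
  refine ⟨fun i => by simp only [myerson]; split_ifs <;> norm_num, ?_⟩
  by_cases h : ∃ i, MyersonWins F b i
  · obtain ⟨i, hi⟩ := h
    rw [Finset.sum_eq_single i]
    · simp [myerson, hi]
    · intro j _ hj
      have : ¬ MyersonWins F b j := fun h => hj (h.unique hi)
      simp [myerson, this]
    · simp
  · push Not at h
    simp [myerson, h]

lemma myersonWins_update {b : Fin n → ℝ} {i : Fin n} {z : ℝ} :
    MyersonWins F (Function.update b i z) i ↔ 0 ≤ ironedVirtualValue (F i) z ∧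
      ∀ j, j ≠ i → ironedVirtualValue (F j) (b j) < ironedVirtualValue (F i) z ∨
        (ironedVirtualValue (F j) (b j) = ironedVirtualValue (F i) z ∧ i < j) := by
  unfold MyersonWins
  rw [Function.update_self]
  refine and_congr_right fun _ => forall₂_congr fun j hj => ?_
  rw [Function.update_of_ne hj]

lemma myersonWins_update_of_le {b : Fin n → ℝ} {i : Fin n} {y z : ℝ}
    (h : ironedVirtualValue (F i) y ≤ ironedVirtualValue (F i) z)
    (hy : MyersonWins F (Function.update b i y) i) :
    MyersonWins F (Function.update b i z) i := by
  rw [myersonWins_update] at hy ⊢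
  refine ⟨hy.1.trans h, fun j hj => ?_⟩
  rcases hy.2 j hj with h1 | ⟨h1, h2⟩
  · exact Or.inl (h1.trans_le h)
  · rcases (h1.trans_le h).lt_or_eq with h3 | h3
    · exact Or.inl h3
    · exact Or.inr ⟨h3, h2⟩

/-- The bids with which player `i` wins against the bids `b`. -/
def winningBids (F : Fin n → Measure ℝ) (b : Fin n → ℝ) (i : Fin n) : Set ℝ :=
  {z | MyersonWins F (Function.update b i z) i}

lemma mem_winningBids {b : Fin n → ℝ} {i : Fin n} {z : ℝ} :
    z ∈ winningBids F b i ↔ MyersonWins F (Function.update b i z) i := Iff.rfl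

lemma winningBids_update (b : Fin n → ℝ) (i : Fin n) (z : ℝ) :
    winningBids F (Function.update b i z) i = winningBids F b i := by
  simp [winningBids]

lemma myerson_alloc_update (b : Fin n → ℝ) (i : Fin n) (z : ℝ) :
    (myerson F).alloc (Function.update b i z) i =
      (winningBids F b i).indicator (fun _ => 1) z := by
  classical
  simp [myerson, winningBids, Set.indicator_apply]

lemma myerson_pay_update (b : Fin n → ℝ) (i : Fin n) (z : ℝ) :
    (myerson F).pay (Function.update b i z) i =
      (winningBids F b i).indicator (fun _ => sInf (winningBids F b i)) z := by
  classical
  simp [myerson, winningBids, Set.indicator_apply]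

end Myerson

/-! ### Myerson's mechanism as posted grid prices. -/

section MyersonGrid

variable {n : ℕ} {D : Fin n → Measure ℝ} [∀ i, IsProbabilityMeasure (D i)] {u : ℕ → ℝ} {k : ℕ}

/-- A player who can win at all faces a posted grid price at which his ironed revenue curve touches
the revenue of that price. -/
lemma winningBids_roundedDist (hg : ∀ i, IsGrid (D i) u k) (b : Fin n → ℝ) (i : Fin n) :
    winningBids (fun i => roundedDist (D i) u k) b i = ∅ ∨
    ∃ l ≤ k, winningBids (fun i => roundedDist (D i) u k) b i = Set.Ici (u l) ∧
      ironedRevenue (roundedDist (D i) u k) (gridQuantile (D i) u l) ≤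
        u l * gridQuantile (D i) u l := by
  have hpos : ∀ z ∈ winningBids (fun i => roundedDist (D i) u k) b i,
      0 ≤ ironedVirtualValue (roundedDist (D i) u k) z :=
    fun z hz => (myersonWins_update.1 (mem_winningBids.1 hz)).1
  have hup : ∀ y ∈ winningBids (fun i => roundedDist (D i) u k) b i, ∀ z,
      ironedVirtualValue (roundedDist (D i) u k) y ≤ ironedVirtualValue (roundedDist (D i) u k) z →
      z ∈ winningBids (fun i => roundedDist (D i) u k) b i :=
    fun y hy z h => mem_winningBids.2 (myersonWins_update_of_le h (mem_winningBids.1 hy))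
  exact (hg i).eq_empty_or_eq_Ici hpos hup

/-- The opponents' bids alone determine a take-it-or-leave-it price, or exclude the player. -/
lemma isDSIC_myerson_roundedDist (hg : ∀ i, IsGrid (D i) u k) :
    (myerson fun i => roundedDist (D i) u k).IsDSIC := by
  intro i b v z
  unfold Mechanism.utility
  rw [myerson_alloc_update, myerson_alloc_update, myerson_pay_update, myerson_pay_update]
  rcases winningBids_roundedDist hg b i with h | ⟨l, _, h, _⟩
  · simp [h]
  · rw [h, csInf_Ici]
    by_cases hv : u l ≤ v <;> by_cases hz : u l ≤ z <;> simp [hv, hz]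
    linarith

lemma isExPostIR_myerson_roundedDist (hg : ∀ i, IsGrid (D i) u k) :
    (myerson fun i => roundedDist (D i) u k).IsExPostIR := by
  intro b i
  unfold Mechanism.utility
  rw [← Function.update_eq_self i b, myerson_alloc_update, myerson_pay_update]
  rcases winningBids_roundedDist hg b i with h | ⟨l, _, h, _⟩
  · simp [h]
  · rw [h, csInf_Ici, Function.update_self]
    by_cases hv : u l ≤ b i <;> simp [hv]

/-- If the price is `u l`, the two sides are `R (q l)` and `u l * q l`, and the curve touches the
revenue there. -/
lemma integral_virtualStep_mul_alloc_le (hg : ∀ i, IsGrid (D i) u k) (w : Fin n → ℝ) (i : Fin n) :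
    ∫ z, virtualStep (D i) u k z *
        (myerson fun i => roundedDist (D i) u k).alloc (Function.update w i z) i ∂(D i) ≤
      ∫ z, (myerson fun i => roundedDist (D i) u k).pay (Function.update w i z) i ∂(D i) := by
  simp_rw [myerson_alloc_update, myerson_pay_update]
  rcases winningBids_roundedDist hg w i with h | ⟨l, hl, h, hle⟩
  · simp [h]
  · rw [h, csInf_Ici, (hg i).integral_virtualStep_Ici hl, integral_indicator measurableSet_Ici,
      setIntegral_const, smul_eq_mul, mul_comm]
    exact hle

lemma measurableSet_myersonWins (hg : ∀ i, IsGrid (D i) u k) (i : Fin n) :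
    MeasurableSet {b | MyersonWins (fun i => roundedDist (D i) u k) b i} := by
  have hφ : ∀ j, Measurable fun b : Fin n → ℝ =>
      ironedVirtualValue (roundedDist (D j) u k) (b j) := fun j =>
    (hg j).monotone_ironedVirtualValue.measurable.comp (measurable_pi_apply j)
  unfold MyersonWins
  simp only [Set.ofPred_and, Set.ofPred_forall, Set.ofPred_or]
  refine (measurableSet_le measurable_const (hφ i)).inter ?_
  refine MeasurableSet.iInter fun j => MeasurableSet.iInter fun _ => ?_
  exact (measurableSet_lt (hφ j) (hφ i)).union
    ((measurableSet_eq_fun (hφ j) (hφ i)).inter (MeasurableSet.const _))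

lemma measurable_myerson_alloc (hg : ∀ i, IsGrid (D i) u k) (i : Fin n) :
    Measurable fun b => (myerson fun i => roundedDist (D i) u k).alloc b i := by
  classical
  exact Measurable.ite (measurableSet_myersonWins hg i) measurable_const measurable_const

/-- This makes the payment visibly measurable: the grid steps from the threshold up to `u k` sum to
`u k` minus the price, so finitely many allocations replace the infimum. -/
lemma myerson_pay_eq (hg : ∀ i, IsGrid (D i) u k) (b : Fin n → ℝ) (i : Fin n) :
    (myerson fun i => roundedDist (D i) u k).pay b i =
      (myerson fun i => roundedDist (D i) u k).alloc b i *
      (u k - ∑ l ∈ Finset.range k, (u (l + 1) - u l) *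
        (myerson fun i => roundedDist (D i) u k).alloc (Function.update b i (u l)) i) := by
  simp_rw [myerson_alloc_update]
  rw [← Function.update_eq_self i b, myerson_alloc_update, myerson_pay_update, winningBids_update]
  rcases winningBids_roundedDist hg b i with h | ⟨l, hl, h, _⟩
  · simp [h]
  · rw [h, csInf_Ici]
    have h1 : ∑ j ∈ Finset.range k, (u (j + 1) - u j) *
        (Set.Ici (u l)).indicator (fun _ => (1 : ℝ)) (u j) = u k - u l := by
      rw [← Finset.sum_Ico_sub u hl]
      have h2 : Finset.Ico l k = (Finset.range k).filter (fun j => l ≤ j) := by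
        ext j; simp [and_comm]
      rw [h2, Finset.sum_filter]
      refine Finset.sum_congr rfl fun j _ => ?_
      by_cases hlj : l ≤ j
      · simp [hlj, (hg i).strictMono.monotone hlj]
      · simp [hlj, (hg i).strictMono (not_le.1 hlj)]
    rw [h1]
    by_cases hb : u l ≤ b i <;> simp [hb]

lemma measurable_myerson_pay (hg : ∀ i, IsGrid (D i) u k) (i : Fin n) :
    Measurable fun b => (myerson fun i => roundedDist (D i) u k).pay b i := by
  simp_rw [myerson_pay_eq hg]
  refine (measurable_myerson_alloc hg i).mul (measurable_const.sub
    (Finset.measurable_sum _ fun l _ => measurable_const.mul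
      ((measurable_myerson_alloc hg i).comp ?_)))
  fun_prop

lemma integrable_myerson_pay (hg : ∀ i, IsGrid (D i) u k) (i : Fin n) :
    Integrable (fun b => (myerson fun i => roundedDist (D i) u k).pay b i) (Measure.pi D) := by
  refine Integrable.of_bound (measurable_myerson_pay hg i).aestronglyMeasurable
    (max |u 0| |u k|) (Filter.Eventually.of_forall fun b => ?_)
  rw [← Function.update_eq_self i b, myerson_pay_update]
  rcases winningBids_roundedDist hg b i with h | ⟨l, hl, h, _⟩
  · simp [h]
  · rw [h, csInf_Ici]
    refine (norm_indicator_le_norm_self _ _).trans ?_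
    exact abs_le_max_abs_abs ((hg i).strictMono.monotone (Nat.zero_le l))
      ((hg i).strictMono.monotone hl)

end MyersonGrid

/-! ### Revenue of a one-buyer menu versus its virtual surplus. -/

section OneBuyer

variable {D : Measure ℝ} [IsProbabilityMeasure D] {u : ℕ → ℝ} {k : ℕ}

/-- The mean of `x` over the `l`-th bin, and the previous such mean if the bin is null. -/
noncomputable def binMean (D : Measure ℝ) (u : ℕ → ℝ) (x : ℝ → ℝ) : ℕ → ℝ
  | 0 => 0
  | l + 1 => if D.real (Set.Ico (u l) (u (l + 1))) = 0 then binMean D u x l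
      else (∫ z in Set.Ico (u l) (u (l + 1)), x z ∂D) / D.real (Set.Ico (u l) (u (l + 1)))

lemma setIntegral_bin_eq (x : ℝ → ℝ) (l : ℕ) :
    ∫ z in Set.Ico (u l) (u (l + 1)), x z ∂D =
      D.real (Set.Ico (u l) (u (l + 1))) * binMean D u x (l + 1) := by
  rw [binMean]
  split_ifs with h
  · rw [h, zero_mul]
    exact setIntegral_measure_zero _ (by rwa [measureReal_eq_zero_iff] at h)
  · field_simp

/-- A bound that holds for almost every value in a bin holds for the bin means. -/
lemma binMean_le_of_forall {x p : ℝ → ℝ} (hx : Integrable x D) (hp : Integrable p D) {l : ℕ}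
    (hm : D.real (Set.Ico (u l) (u (l + 1))) ≠ 0) {α β γ : ℝ}
    (h : ∀ᵐ z ∂D, z ∈ Set.Ico (u l) (u (l + 1)) → α * x z + β * p z ≤ γ) :
    α * binMean D u x (l + 1) + β * binMean D u p (l + 1) ≤ γ := by
  have hpos : 0 < D.real (Set.Ico (u l) (u (l + 1))) := lt_of_le_of_ne measureReal_nonneg hm.symm
  have h1 : ∫ z in Set.Ico (u l) (u (l + 1)), (α * x z + β * p z) ∂D ≤
      ∫ z in Set.Ico (u l) (u (l + 1)), γ ∂D :=
    setIntegral_mono_on_ae ((hx.const_mul α).add (hp.const_mul β)).integrableOn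
      (integrable_const γ).integrableOn measurableSet_Ico h
  rw [integral_add (hx.const_mul α).integrableOn (hp.const_mul β).integrableOn, integral_const_mul,
    integral_const_mul, setIntegral_bin_eq, setIntegral_bin_eq, setIntegral_const,
    smul_eq_mul] at h1
  refine le_of_mul_le_mul_left ?_ hpos
  linarith

/-- An incentive compatible and individually rational menu `(x, p)` earns from one buyer at most a
`c`-multiple of what its allocation earns in ironed virtual values of the rounded distribution,
where `c` bounds the loss by rounding. -/
lemma IsGrid.integral_pay_le (hg : IsGrid D u k) {x p : ℝ → ℝ} (hx : Integrable x D)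
    (hp : Integrable p D) {T : Set ℝ} (hT : ∀ᵐ z ∂D, z ∈ T) (hx0 : ∀ z ∈ T, 0 ≤ x z)
    (ic : ∀ v ∈ T, ∀ z ∈ T, v * x z - p z ≤ v * x v - p v)
    (ir : ∀ v ∈ T, 0 ≤ v * x v - p v) {c : ℝ} (hc0 : 0 ≤ c)
    (hc : ∀ l ≤ k, ∀ᵐ z ∂D, z ∈ Set.Ico (u l) (u (l + 1)) → z ≤ c * u l) :
    ∫ z, p z ∂D ≤ c * ∫ z, virtualStep D u k z * x z ∂D := by
  set X := binMean D u x with hX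
  set P := binMean D u p with hP
  have hmono : ∀ v ∈ T, ∀ z ∈ T, z < v → x z ≤ x v := by
    intro v hv z hz hzv
    nlinarith [ic v hv z hz, ic z hz v hv]
  -- A type above `u l` does not envy the averaged option of the last non-null bin below it. Index 0
  -- is the outside option `(0, 0)`, where this is individual rationality.
  have inv : ∀ l, ∀ v ∈ T, u l ≤ v → X l ≤ x v ∧ p v ≤ P l + v * (x v - X l) := by
    intro l
    induction l with
    | zero =>
      intro v hv _
      have h1 := ir v hv
      have h2 := hx0 v hv
      simp only [hX, hP, binMean]
      constructor <;> linarith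
    | succ l ih =>
      intro v hv hlv
      by_cases hm : D.real (Set.Ico (u l) (u (l + 1))) = 0
      · have h1 : X (l + 1) = X l := by simp [hX, binMean, hm]
        have h2 : P (l + 1) = P l := by simp [hP, binMean, hm]
        rw [h1, h2]
        exact ih v hv ((hg.strictMono (Nat.lt_succ_self l)).le.trans hlv)
      · have h1 := binMean_le_of_forall hx hp hm (α := 1) (β := 0) (γ := x v) (by
          filter_upwards [hT] with z hz hzl
          linarith [hmono v hv z hz (hzl.2.trans_le hlv)])
        have h2 := binMean_le_of_forall hx hp hm (α := v) (β := -1) (γ := v * x v - p v) (by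
          filter_upwards [hT] with z hz hzl
          linarith [ic v hv z hz])
        constructor <;> linarith
  -- Average `inv` over bin `l`, using `z ≤ c * u l` there; over a null bin the means do not change.
  have hstep : ∀ l ≤ k, X l ≤ X (l + 1) ∧ P (l + 1) - P l ≤ c * u l * (X (l + 1) - X l) := by
    intro l hl
    by_cases hm : D.real (Set.Ico (u l) (u (l + 1))) = 0
    · have h1 : X (l + 1) = X l := by simp [hX, binMean, hm]
      have h2 : P (l + 1) = P l := by simp [hP, binMean, hm]
      rw [h1, h2]
      simp
    · have h1 := binMean_le_of_forall hx hp hm (α := -1) (β := 0) (γ := -X l) (by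
        filter_upwards [hT] with z hz hzl
        linarith [(inv l z hz hzl.1).1])
      have h2 := binMean_le_of_forall hx hp hm (α := -(c * u l)) (β := 1)
        (γ := P l - c * u l * X l) (by
        filter_upwards [hT, hc l hl] with z hz hzc hzl
        have h3 := inv l z hz hzl.1
        have h4 := mul_le_mul_of_nonneg_right (hzc hzl) (sub_nonneg.2 h3.1)
        linarith)
      constructor <;> linarith
  set q := gridQuantile D u with hq
  set f := fun l => ironedRevenue (roundedDist D u k) (q l) with hf
  have hbins : ∫ z, p z ∂D =
      ∑ l ∈ Finset.range (k + 1), ∫ z in Set.Ico (u l) (u (l + 1)), p z ∂D := by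
    rw [← integral_biUnion_finset _ (fun l _ => measurableSet_Ico) ?_
      (fun l _ => hp.integrableOn)]
    · symm
      refine setIntegral_eq_integral_of_ae_compl_eq_zero ?_
      filter_upwards [hg.ae_mem_bin] with z ⟨l, hl, hz, _⟩ hnot
      exact absurd (Set.mem_iUnion₂.2 ⟨l, Finset.mem_range_succ_iff.2 hl, hz⟩) hnot
    · intro l _ j _ hlj
      refine Set.disjoint_left.2 fun z hz hz' => hlj (hg.eq_of_mem hz hz').symm
  -- Summation by parts with vanishing boundary terms, applied both to the quantiles with `P` and to
  -- the curve with `X`.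
  have abel : ∀ g Y : ℕ → ℝ, g (k + 1) = 0 → Y 0 = 0 →
      ∑ l ∈ Finset.range (k + 1), (g l - g (l + 1)) * Y (l + 1) =
      ∑ l ∈ Finset.range (k + 1), g l * (Y (l + 1) - Y l) := by
    intro g Y hgk hY
    have h := Finset.sum_range_sub (fun l => g l * Y l) (k + 1)
    rw [hgk, hY, zero_mul, mul_zero, sub_zero] at h
    rw [← sub_eq_zero, ← Finset.sum_sub_distrib, ← neg_eq_zero, ← Finset.sum_neg_distrib, ← h]
    exact Finset.sum_congr rfl fun l _ => by ring
  have hleft : ∫ z, p z ∂D = ∑ l ∈ Finset.range (k + 1), q l * (P (l + 1) - P l) := by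
    rw [hbins, ← abel q P hg.quantile_last rfl]
    refine Finset.sum_congr rfl fun l _ => ?_
    rw [setIntegral_bin_eq, hg.real_Ico (Nat.le_succ l)]
  have hright : ∫ z, virtualStep D u k z * x z ∂D =
      ∑ l ∈ Finset.range (k + 1), f l * (X (l + 1) - X l) := by
    rw [integral_virtualStep_mul hx, ← abel f X (by
      simp only [hf, hq, hg.quantile_last, hg.ironedRevenue_zero]) rfl]
    refine Finset.sum_congr rfl fun l _ => ?_
    rw [setIntegral_bin_eq, hg.real_Ico (Nat.le_succ l), ← mul_assoc, hg.gridSlope_mul]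
  rw [hleft, hright, Finset.mul_sum]
  refine Finset.sum_le_sum fun l hl => ?_
  have hl' : l ≤ k := by simpa [Nat.lt_succ_iff] using hl
  obtain ⟨h1, h2⟩ := hstep l hl'
  calc q l * (P (l + 1) - P l) ≤ q l * (c * u l * (X (l + 1) - X l)) :=
        mul_le_mul_of_nonneg_left h2 (gridQuantile_mem l).1
    _ = c * ((u l * q l) * (X (l + 1) - X l)) := by ring
    _ ≤ c * (f l * (X (l + 1) - X l)) := mul_le_mul_of_nonneg_left
        (mul_le_mul_of_nonneg_right (hg.le_ironedRevenue_grid hl') (sub_nonneg.2 h1)) hc0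

end OneBuyer

/-! ### Product priors and the revenue comparison. -/

section Product

variable {n : ℕ} {D : Fin n → Measure ℝ} [∀ i, IsProbabilityMeasure (D i)]

/-- Redrawing one coordinate independently preserves a product distribution. -/
lemma measurePreserving_update (D : Fin n → Measure ℝ) [∀ i, IsProbabilityMeasure (D i)]
    (i : Fin n) :
    MeasurePreserving (fun p : (Fin n → ℝ) × ℝ => Function.update p.1 i p.2)
      ((Measure.pi D).prod (D i)) (Measure.pi D) := by
  classical
  have hmeas : Measurable (fun p : (Fin n → ℝ) × ℝ => Function.update p.1 i p.2) := by
    refine measurable_pi_iff.2 fun j => ?_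
    by_cases hj : j = i
    · subst hj
      simpa using measurable_snd
    · simp only [Function.update_of_ne hj]
      fun_prop
  refine ⟨hmeas, (Measure.pi_eq fun s hs => ?_).symm⟩
  rw [Measure.map_apply hmeas (MeasurableSet.univ_pi hs)]
  have hpre : (fun p : (Fin n → ℝ) × ℝ => Function.update p.1 i p.2) ⁻¹' Set.univ.pi s =
      (Set.univ.pi (Function.update s i Set.univ)) ×ˢ s i := by
    ext ⟨w, z⟩
    simp only [Set.mem_preimage, Set.mem_univ_pi, Set.mem_prod]
    constructor
    · intro h
      refine ⟨fun j => ?_, by simpa using h i⟩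
      by_cases hj : j = i
      · subst hj; simp
      · simpa [Function.update_of_ne hj] using h j
    · rintro ⟨h1, h2⟩ j
      by_cases hj : j = i
      · subst hj; simpa using h2
      · simpa [Function.update_of_ne hj] using h1 j
  rw [hpre, Measure.prod_prod, Measure.pi_pi, ← Finset.prod_erase_mul _ _ (Finset.mem_univ i),
    ← Finset.prod_erase_mul _ (fun j => D j (s j)) (Finset.mem_univ i)]
  simp only [Function.update_self, measure_univ, mul_one]
  congr 1
  refine Finset.prod_congr rfl fun j hj => ?_
  rw [Function.update_of_ne (Finset.ne_of_mem_erase hj)]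

lemma integrable_comp_update (i : Fin n) {g : (Fin n → ℝ) → ℝ} (hg : Integrable g (Measure.pi D)) :
    Integrable (fun p : (Fin n → ℝ) × ℝ => g (Function.update p.1 i p.2))
      ((Measure.pi D).prod (D i)) :=
  ((measurePreserving_update D i).integrable_comp hg.aestronglyMeasurable).2 hg

lemma integral_comp_update (i : Fin n) {g : (Fin n → ℝ) → ℝ} (hg : Integrable g (Measure.pi D)) :
    ∫ p : (Fin n → ℝ) × ℝ, g (Function.update p.1 i p.2) ∂((Measure.pi D).prod (D i)) =
      ∫ v, g v ∂(Measure.pi D) := by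
  have h := (measurePreserving_update D i).map_eq
  conv_rhs => rw [← h]
  rw [integral_map (measurePreserving_update D i).measurable.aemeasurable]
  rw [h]
  exact hg.aestronglyMeasurable

lemma integral_eq_integral_update (i : Fin n) {g : (Fin n → ℝ) → ℝ}
    (hg : Integrable g (Measure.pi D)) :
    ∫ v, g v ∂(Measure.pi D) = ∫ w, ∫ z, g (Function.update w i z) ∂(D i) ∂(Measure.pi D) := by
  rw [← integral_comp_update i hg, integral_prod _ (integrable_comp_update i hg)]

lemma integral_eq_integral_update_symm (i : Fin n) {g : (Fin n → ℝ) → ℝ}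
    (hg : Integrable g (Measure.pi D)) :
    ∫ v, g v ∂(Measure.pi D) = ∫ z, ∫ w, g (Function.update w i z) ∂(Measure.pi D) ∂(D i) := by
  rw [← integral_comp_update i hg, integral_prod_symm _ (integrable_comp_update i hg)]

lemma Mechanism.IsFeasible.alloc_le_one {M : Mechanism n} (hM : M.IsFeasible) (b : Fin n → ℝ)
    (i : Fin n) : M.alloc b i ≤ 1 :=
  (Finset.single_le_sum (fun j _ => (hM b).1 j) (Finset.mem_univ i)).trans (hM b).2

lemma Mechanism.IsFeasible.norm_alloc_le_one {M : Mechanism n} (hM : M.IsFeasible)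
    (b : Fin n → ℝ) (i : Fin n) : ‖M.alloc b i‖ ≤ 1 := by
  rw [Real.norm_of_nonneg ((hM b).1 i)]
  exact hM.alloc_le_one b i

variable {u : ℕ → ℝ} {k : ℕ}

lemma integrable_virtualStep_mul_alloc {M : Mechanism n} (hM : M.IsFeasible) {i : Fin n}
    (hm : Measurable fun b => M.alloc b i) :
    Integrable (fun v => virtualStep (D i) u k (v i) * M.alloc v i) (Measure.pi D) := by
  refine (Integrable.of_bound hm.aestronglyMeasurable 1
    (Filter.Eventually.of_forall fun b => hM.norm_alloc_le_one b i)).bdd_mul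
    (c := ∑ l ∈ Finset.range (k + 1), |gridSlope (D i) u k l|)
    (measurable_virtualStep.comp (measurable_pi_apply i)).aestronglyMeasurable
    (Filter.Eventually.of_forall fun b => norm_virtualStep_le _)

lemma integral_virtualStep_mul_myerson_alloc_le (hg : ∀ i, IsGrid (D i) u k) (i : Fin n) :
    ∫ v, virtualStep (D i) u k (v i) * (myerson fun i => roundedDist (D i) u k).alloc v i
        ∂(Measure.pi D) ≤
      ∫ v, (myerson fun i => roundedDist (D i) u k).pay v i ∂(Measure.pi D) := by
  have h1 := integrable_virtualStep_mul_alloc (D := D) (u := u) (k := k)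
    (isFeasible_myerson fun i => roundedDist (D i) u k) (measurable_myerson_alloc hg i)
  have h2 := integrable_myerson_pay hg i
  rw [integral_eq_integral_update i h1, integral_eq_integral_update i h2]
  refine integral_mono (integrable_comp_update i h1).integral_prod_left
    (integrable_comp_update i h2).integral_prod_left fun w => ?_
  simpa using integral_virtualStep_mul_alloc_le hg w i

/-- Integrating out the opponents leaves a one-buyer menu. Its constraints are available on the
support of `D i`, which has full measure and serves as `T`. -/
lemma Mechanism.IsBIC.integral_pay_le {M : Mechanism n} (hM : M.IsBIC D)
    {i : Fin n} (hg : IsGrid (D i) u k) {c : ℝ} (hc0 : 0 ≤ c)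
    (hc : ∀ l ≤ k, ∀ᵐ z ∂(D i), z ∈ Set.Ico (u l) (u (l + 1)) → z ≤ c * u l) :
    ∫ v, M.pay v i ∂(Measure.pi D) ≤
      c * ∫ v, virtualStep (D i) u k (v i) * M.alloc v i ∂(Measure.pi D) := by
  have halloc : Integrable (fun v => M.alloc v i) (Measure.pi D) :=
    Integrable.of_bound (hM.measurable_alloc i).aestronglyMeasurable 1
      (Filter.Eventually.of_forall fun b => hM.feasible.norm_alloc_le_one b i)
  have hupd : ∀ z, Measurable fun w : Fin n → ℝ => Function.update w i z := fun z => by fun_prop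
  have halloc' : ∀ z, Integrable (fun w => M.alloc (Function.update w i z) i) (Measure.pi D) :=
    fun z => Integrable.of_bound ((hM.measurable_alloc i).comp (hupd z)).aestronglyMeasurable 1
      (Filter.Eventually.of_forall fun b => hM.feasible.norm_alloc_le_one _ i)
  have hint := integrable_virtualStep_mul_alloc (D := D) (u := u) (k := k) hM.feasible
    (hM.measurable_alloc i)
  rw [integral_eq_integral_update_symm i (hM.integrable_pay i),
    integral_eq_integral_update_symm i hint]
  simp only [Function.update_self, integral_const_mul]
  have hutil : ∀ v, ∀ z ∈ (D i).support, M.interimUtility D i v z =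
      v * ∫ w, M.alloc (Function.update w i z) i ∂(Measure.pi D) -
        ∫ w, M.pay (Function.update w i z) i ∂(Measure.pi D) := by
    intro v z hz
    unfold Mechanism.interimUtility Mechanism.utility
    rw [integral_sub ((halloc' z).const_mul v) (hM.integrable_interim i z hz), integral_const_mul]
  refine hg.integral_pay_le (integrable_comp_update i halloc).integral_prod_right
    (integrable_comp_update i (hM.integrable_pay i)).integral_prod_right
    (T := (D i).support) Measure.support_mem_ae
    (fun z _ => integral_nonneg fun w => (hM.feasible _).1 i) ?_ ?_ hc0 hc
  · intro v hv z hz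
    rw [← hutil v z hz, ← hutil v v hv]
    exact hM.ic i v hv z hz
  · intro v hv
    rw [← hutil v v hv]
    exact hM.ir i v hv

/-- Myerson's allocation maximizes the virtual welfare. -/
lemma sum_mul_alloc_le_myerson {F : Fin n → Measure ℝ} {M : Mechanism n} (hM : M.IsFeasible)
    {v : Fin n → ℝ} {φ : Fin n → ℝ} (hφ : ∀ i, ironedVirtualValue (F i) (v i) = (φ i : EReal)) :
    ∑ i, φ i * M.alloc v i ≤ ∑ i, φ i * (myerson F).alloc v i := by
  classical
  obtain ⟨h0, h1⟩ := hM v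
  by_cases hpos : ∃ i, 0 ≤ φ i
  · obtain ⟨i0, hi0⟩ := hpos
    obtain ⟨m, _, hm⟩ := Finset.exists_max_image Finset.univ φ ⟨i0, Finset.mem_univ i0⟩
    have hne : (Finset.univ.filter fun i => φ i = φ m).Nonempty := ⟨m, by simp⟩
    -- The smallest maximizing index is the one selected by the tie-breaking rule.
    set i := (Finset.univ.filter fun i => φ i = φ m).min' hne with hi
    have him : φ i = φ m := by simpa using Finset.min'_mem _ hne
    have hwin : MyersonWins F v i := by
      refine ⟨?_, fun j hj => ?_⟩
      · rw [hφ i, him, EReal.coe_nonneg]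
        exact hi0.trans (hm i0 (Finset.mem_univ i0))
      · rw [hφ i, hφ j, EReal.coe_lt_coe_iff, EReal.coe_eq_coe_iff, him]
        rcases (hm j (Finset.mem_univ j)).lt_or_eq with h | h
        · exact Or.inl h
        · exact Or.inr ⟨h, lt_of_le_of_ne (Finset.min'_le _ _ (by simp [h])) hj.symm⟩
    have hR : ∑ j, φ j * (myerson F).alloc v j = φ m := by
      rw [Finset.sum_eq_single i]
      · simp [myerson, hwin, him]
      · intro j _ hj
        have : ¬ MyersonWins F v j := fun h => hj (h.unique hwin)
        simp [myerson, this]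
      · simp
    rw [hR]
    calc ∑ j, φ j * M.alloc v j ≤ ∑ j, φ m * M.alloc v j := Finset.sum_le_sum fun j hj =>
          mul_le_mul_of_nonneg_right (hm j hj) (h0 j)
      _ = φ m * ∑ j, M.alloc v j := by rw [Finset.mul_sum]
      _ ≤ φ m := mul_le_of_le_one_right (hi0.trans (hm i0 (Finset.mem_univ i0))) h1
  · push Not at hpos
    have hno : ∀ i, ¬ MyersonWins F v i := fun i h => by
      have := h.1
      rw [hφ i, EReal.coe_nonneg] at this
      linarith [hpos i]
    refine Finset.sum_le_sum fun i _ => ?_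
    have : (myerson F).alloc v i = 0 := by simp [myerson, hno i]
    rw [this, mul_zero]
    exact mul_nonpos_of_nonpos_of_nonneg (hpos i).le (h0 i)

theorem Mechanism.IsBIC.revenue_le {M : Mechanism n} (hM : M.IsBIC D)
    (hg : ∀ i, IsGrid (D i) u k) {c : ℝ} (hc0 : 0 ≤ c)
    (hc : ∀ i, ∀ l ≤ k, ∀ᵐ z ∂(D i), z ∈ Set.Ico (u l) (u (l + 1)) → z ≤ c * u l) :
    M.revenue D ≤ c * (myerson fun i => roundedDist (D i) u k).revenue D := by
  have hM' := fun i => integrable_virtualStep_mul_alloc (D := D) (u := u) (k := k) hM.feasible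
    (hM.measurable_alloc i)
  have hF' := fun i => integrable_virtualStep_mul_alloc (D := D) (u := u) (k := k)
    (isFeasible_myerson fun i => roundedDist (D i) u k) (measurable_myerson_alloc hg i)
  have hae : ∀ᵐ v ∂(Measure.pi D), ∀ i, ironedVirtualValue (roundedDist (D i) u k) (v i) =
      (virtualStep (D i) u k (v i) : EReal) := ae_all_iff.2 fun i =>
    (measurePreserving_eval D i).quasiMeasurePreserving.ae (hg i).ae_ironedVirtualValue_eq
  unfold Mechanism.revenue
  rw [integral_finsetSum _ fun i _ => hM.integrable_pay i,
    integral_finsetSum _ fun i _ => integrable_myerson_pay hg i]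
  calc ∑ i, ∫ v, M.pay v i ∂(Measure.pi D)
      ≤ ∑ i, c * ∫ v, virtualStep (D i) u k (v i) * M.alloc v i ∂(Measure.pi D) :=
        Finset.sum_le_sum fun i _ => hM.integral_pay_le (hg i) hc0 (hc i)
    _ = c * ∫ v, ∑ i, virtualStep (D i) u k (v i) * M.alloc v i ∂(Measure.pi D) := by
        rw [← Finset.mul_sum, integral_finsetSum _ fun i _ => hM' i]
    _ ≤ c * ∫ v, ∑ i, virtualStep (D i) u k (v i) *
          (myerson fun i => roundedDist (D i) u k).alloc v i ∂(Measure.pi D) := by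
        refine mul_le_mul_of_nonneg_left ?_ hc0
        refine integral_mono_ae (integrable_finsetSum _ fun i _ => hM' i)
          (integrable_finsetSum _ fun i _ => hF' i) ?_
        filter_upwards [hae] with v hv
        exact sum_mul_alloc_le_myerson hM.feasible hv
    _ = c * ∑ i, ∫ v, virtualStep (D i) u k (v i) *
          (myerson fun i => roundedDist (D i) u k).alloc v i ∂(Measure.pi D) := by
        rw [integral_finsetSum _ fun i _ => hF' i]
    _ ≤ _ := mul_le_mul_of_nonneg_left (Finset.sum_le_sum fun i _ =>
        integral_virtualStep_mul_myerson_alloc_le hg i) hc0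

end Product

/-! ### The geometric grid -/

/-- The grid values `1, 1+δ, …, (1+δ)^(k-1), H`, continued beyond `H`. -/
noncomputable def extendedGrid (H δ : ℝ) (l : ℕ) : ℝ :=
  if l < gridSize H δ then (1 + δ) ^ l else H + ((l : ℝ) - gridSize H δ)

section GeometricGrid

variable {H δ : ℝ}

lemma gridValue_eq_extendedGrid (l : Fin (gridSize H δ + 1)) :
    gridValue H δ l = extendedGrid H δ l := by
  unfold gridValue extendedGrid
  have := l.2
  split_ifs with h1 h2 h2
  · omega
  · rw [h1]; ring
  · rfl
  · omega

lemma pow_lt_of_lt_gridSize (hδ : 0 < δ) (hH : 1 ≤ H) {l : ℕ} (hl : l < gridSize H δ) :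
    (1 + δ) ^ l < H := by
  have h := Nat.lt_ceil.1 hl
  rwa [Real.lt_logb_iff_rpow_lt (by linarith) (by linarith), Real.rpow_natCast] at h

lemma le_pow_gridSize (hδ : 0 < δ) (hH : 1 ≤ H) : H ≤ (1 + δ) ^ gridSize H δ := by
  have h := Nat.le_ceil (Real.logb (1 + δ) H)
  rwa [Real.logb_le_iff_le_rpow (by linarith) (by linarith), Real.rpow_natCast] at h

lemma strictMono_extendedGrid (hδ : 0 < δ) (hH : 1 ≤ H) : StrictMono (extendedGrid H δ) := by
  refine strictMono_nat_of_lt_succ fun l => ?_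
  unfold extendedGrid
  split_ifs with h1 h2 h2
  · exact pow_lt_pow_right₀ (by linarith) (Nat.lt_succ_self l)
  · have h3 := pow_lt_of_lt_gridSize hδ hH h1
    have h4 : l + 1 = gridSize H δ := by omega
    rw [← h4]
    simpa using h3
  · omega
  · push_cast
    linarith

lemma extendedGrid_zero (hδ : 0 < δ) (hH : 1 ≤ H) : extendedGrid H δ 0 = 1 := by
  unfold extendedGrid
  split_ifs with h
  · simp
  · have h0 : gridSize H δ = 0 := by omega
    have := le_pow_gridSize hδ hH
    rw [h0, pow_zero] at this
    rw [h0]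
    simpa using le_antisymm this hH

lemma extendedGrid_succ_le (hδ : 0 < δ) (hH : 1 ≤ H) {l : ℕ} (hl : l < gridSize H δ) :
    extendedGrid H δ (l + 1) ≤ (1 + δ) * extendedGrid H δ l := by
  have h : extendedGrid H δ l = (1 + δ) ^ l := if_pos hl
  rw [h, ← pow_succ']
  unfold extendedGrid
  split_ifs with h2
  · exact le_rfl
  · have h4 : l + 1 = gridSize H δ := by omega
    have := le_pow_gridSize hδ hH
    rw [h4]
    simpa using this

lemma extendedGrid_gridSize : extendedGrid H δ (gridSize H δ) = H := by
  simp [extendedGrid]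

/-- Consecutive grid values differ by a factor of at most `1 + δ`, except in the artificial last bin
`[H, H + 1)`, where `z ≤ H` is used instead. -/
lemma le_mul_extendedGrid (hδ : 0 < δ) (hH : 1 ≤ H) {l : ℕ} (hl : l ≤ gridSize H δ) {z : ℝ}
    (hz : z < extendedGrid H δ (l + 1)) (hzH : z ≤ H) : z ≤ (1 + δ) * extendedGrid H δ l := by
  rcases hl.lt_or_eq with h | rfl
  · exact hz.le.trans (extendedGrid_succ_le hδ hH h)
  · rw [extendedGrid_gridSize]
    nlinarith

variable {D : Measure ℝ}

/-- The default answer 0 after the last query is the true quantile of the extra grid point beyond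
`H`. -/
lemma learnedDist_eq_roundedDist (hg : IsGrid D (extendedGrid H δ) (gridSize H δ)) :
    learnedDist H δ (fun l => D.real (Set.Ici (gridValue H δ l))) =
      roundedDist D (extendedGrid H δ) (gridSize H δ) := by
  unfold learnedDist roundedDist
  rw [Finset.sum_range]
  refine Finset.sum_congr rfl fun l _ => ?_
  simp only [gridValue_eq_extendedGrid]
  congr 3
  split_ifs with h
  · rfl
  · have : (l : ℕ) + 1 = gridSize H δ + 1 := by have := l.2; omega
    rw [this, hg.quantile_last]

variable [IsProbabilityMeasure D]

lemma isGrid_extendedGrid (hδ : 0 < δ) (hH : 1 ≤ H) (hD : ∀ᵐ x ∂D, x ∈ Set.Icc 1 H) :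
    IsGrid D (extendedGrid H δ) (gridSize H δ) := by
  refine ⟨strictMono_extendedGrid hδ hH, ?_, ?_⟩
  · have h : Set.Ici (extendedGrid H δ 0) ∈ ae D := by
      rw [extendedGrid_zero hδ hH]
      filter_upwards [hD] with x hx using hx.1
    rw [gridQuantile, measureReal_def, (mem_ae_iff_prob_eq_one measurableSet_Ici).1 h,
      ENNReal.toReal_one]
  · rw [gridQuantile, measureReal_eq_zero_iff, measure_eq_zero_iff_ae_notMem]
    filter_upwards [hD] with x hx h
    have h1 := strictMono_extendedGrid hδ hH (Nat.lt_succ_self (gridSize H δ))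
    rw [extendedGrid_gridSize] at h1
    exact absurd (h1.trans_le h) (not_lt.2 hx.2)

end GeometricGrid

/-- The ceiling and the extra endpoint each cost at most one query beyond the logarithm, hence the
factor 3. -/
lemma queryComplexity_efficientValueMyerson_le (n : ℕ) {ε H : ℝ} (hε : 0 < ε) (hH : 1 ≤ H) :
    ((efficientValueMyerson n H ε).queryComplexity : ℝ)
      ≤ 3 * (n * max 1 (Real.logb (1 + ε) H)) := by
  have h1 : (efficientValueMyerson n H ε).queryComplexity = n * (gridSize H ε + 1) := by
    simp [ValueQueryMechanism.queryComplexity, efficientValueMyerson]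
  have h2 : (gridSize H ε : ℝ) < Real.logb (1 + ε) H + 1 :=
    Nat.ceil_lt_add_one (Real.logb_nonneg (by linarith) hH)
  have h3 := le_max_left 1 (Real.logb (1 + ε) H)
  have h4 := le_max_right 1 (Real.logb (1 + ε) H)
  rw [h1]
  push_cast
  have := mul_le_mul_of_nonneg_left
    (show (gridSize H ε : ℝ) + 1 ≤ 3 * max 1 (Real.logb (1 + ε) H) by linarith)
    (Nat.cast_nonneg (α := ℝ) n)
  linarith

end SingleItemAuction

/-! ### The approximation guarantee. -/

open SingleItemAuction in
theorem mainTheorem4 :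
    ∃ C : ℝ, 0 < C ∧ ∀ (n : ℕ) (ε H : ℝ), 0 < ε → 1 ≤ H →
      ((efficientValueMyerson n H ε).queryComplexity : ℝ)
          ≤ C * (n * max 1 (Real.logb (1 + ε) H)) ∧
      ∀ (D : Fin n → Measure ℝ) [∀ i, IsProbabilityMeasure (D i)],
        (∀ i, ∀ᵐ x ∂(D i), x ∈ Set.Icc 1 H) →
          ((efficientValueMyerson n H ε).onPrior D).IsFeasible ∧
          ((efficientValueMyerson n H ε).onPrior D).IsExPostIR ∧
          ((efficientValueMyerson n H ε).onPrior D).IsDSIC ∧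
          (∀ i, Integrable (fun v => ((efficientValueMyerson n H ε).onPrior D).pay v i)
            (Measure.pi D)) ∧
          OPT D / ((1 + ε : ℝ) : EReal)
            ≤ (((efficientValueMyerson n H ε).onPrior D).revenue D : EReal) := by
  refine ⟨3, by norm_num, fun n ε H hε hH =>
    ⟨queryComplexity_efficientValueMyerson_le n hε hH, fun D _ hD => ?_⟩⟩
  have hg : ∀ i, IsGrid (D i) (extendedGrid H ε) (gridSize H ε) := fun i =>
    isGrid_extendedGrid hε hH (hD i)
  have hM : (efficientValueMyerson n H ε).onPrior D =
      myerson fun i => roundedDist (D i) (extendedGrid H ε) (gridSize H ε) := by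
    have h := funext fun i => learnedDist_eq_roundedDist (hg i)
    exact congrArg myerson h
  rw [hM]
  refine ⟨isFeasible_myerson _, isExPostIR_myerson_roundedDist hg, isDSIC_myerson_roundedDist hg,
    integrable_myerson_pay hg, ?_⟩
  rw [EReal.div_le_iff_le_mul (EReal.coe_pos.2 (by linarith)) (EReal.coe_ne_top _),
    ← EReal.coe_mul]
  refine iSup₂_le fun M hBIC => EReal.coe_le_coe_iff.2 ?_
  refine hBIC.revenue_le hg (by linarith) fun i l hl => ?_
  filter_upwards [hD i] with z hz hzl
  exact le_mul_extendedGrid hε hH hl hzl.2 hz.2
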